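/- Let $\mathcal A\neq\{0\}$ be a unital $C^*$-algebra and let $a,b\in\mathcal A$ be self-adjoint. A state on $\mathcal A$ is a positive linear functional $\omega:\mathcal A\to\mathbb C$ with $\omega(1)=1$; let $(\mathcal H_\omega,\pi_\omega,\Psi_\omega)$ be its GNS triple. For a self-adjoint $c\in\mathcal A$ let $\mu_\omega^{c}$ be the spectral measure of the bounded self-adjoint operator $\pi_\omega(c)$ at the vector $\Psi_\omega$, that is, $\mu_\omega^{c}(E)=\langle\Psi_\omega, P(E)\Psi_\omega\rangle$ for Borel sets $E\subseteq\mathbb R$, where $P$ is the projection-valued measure of $\pi_\omega(c)$. Let $\sigma_p(\pi_\omega(c))$ be the set of eigenvalues of $\pi_\omega(c)$ and $\sigma_c(\pi_\omega(c))=\sigma(\pi_\omega(c))\setminus\sigma_p(\pi_\omega(c))$ the continuous part of its spectrum. A partition $\varepsilon$ for $c$ is a choice, for every state $\omega$, of an at most countable family $\{E_i\}_{i\in I_\omega}$ of pairwise disjoint sets with union $\sigma_c(\pi_\omega(c))$, each of them a Borel subset of the topological space $\sigma_c(\pi_\omega(c))$ (if $\sigma_c(\pi_\omega(c))$ is not a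 Borel set of $\mathbb R$, $\mu_\omega^c(E_i)$ is understood as the outer measure). The $\varepsilon$-Shannon entropy of $c$ in the state $\omega$ is $$H_\omega(c;\varepsilon)=-\sum_{\lambda\in\sigma_p(\pi_\omega(c))}\mu_\omega^c(\{\lambda\})\log\mu_\omega^c(\{\lambda\})-\sum_{i\in I_\omega}\mu_\omega^c(E_i)\log\mu_\omega^c(E_i)\in[0,\infty],\qquad 0\log 0=0 .$$ Let $\varepsilon$ be a partition for $a$ and $\delta$ a partition for $b$. If there is a real constant $C=C(\varepsilon,\delta)>0$, not depending on the state, such that $$H_\omega(a;\varepsilon)+H_\omega(b;\delta)\ \geq\ C(\varepsilon,\delta)\qquad\text{for every state }\omega\text{ on }\mathcal A,$$ then $[a,b]=ab-ba\neq 0$. -/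

import Mathlib

open scoped ComplexOrder InnerProductSpace CompactlySupported ENNReal

noncomputable section

/-! ### Spectral measures of bounded self-adjoint operators -/

section Spectral

variable {H : Type*} [NormedAddCommGroup H] [InnerProductSpace ℂ H] [CompleteSpace H]

/-- The positive linear functional `f ↦ ⟪x, f(T) x⟫` on real continuous functions of compact
support, where `f(T)` is the continuous functional calculus of the self-adjoint operator `T`. -/
def spectralFunctional (T : H →L[ℂ] H) (x : H) : C_c(ℝ, ℝ) →ₚ[ℝ] ℝ :=
  PositiveLinearMap.mk₀
    { toFun := fun f => (⟪x, cfc (f : ℝ → ℝ) T x⟫_ℂ).re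
      map_add' := fun f g => by
        have h : cfc (⇑(f + g)) T = cfc (⇑f) T + cfc (⇑g) T :=
          cfc_add T (⇑f) (⇑g) f.continuous.continuousOn g.continuous.continuousOn
        rw [h, _root_.add_apply, inner_add_right, Complex.add_re]
      map_smul' := fun c f => by
        have h : cfc (⇑(c • f)) T = c • cfc (⇑f) T :=
          cfc_smul c (⇑f) T f.continuous.continuousOn
        rw [h, _root_.smul_apply, ← Complex.coe_smul, inner_smul_right]
        simp }
    (fun f hf => by
      have h : (0 : H →L[ℂ] H) ≤ cfc (⇑f) T := cfc_nonneg fun t _ => hf t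
      have h' := (ContinuousLinearMap.nonneg_iff_isPositive _).1 h
      exact (Complex.le_def.1 (h'.inner_nonneg_right x)).1)

/-- The spectral measure of the self-adjoint operator `T` at the vector `x`: the Borel measure `μ`
on `ℝ` with `∫ f dμ = ⟪x, f(T) x⟫`, which is the measure `E ↦ ⟪x, P(E) x⟫`, where `P` is the
projection-valued measure of `T`. -/
def spectralMeasure (T : H →L[ℂ] H) (x : H) : MeasureTheory.Measure ℝ :=
  RealRMK.rieszMeasure (spectralFunctional T x)

/-- The defining property of the spectral measure. -/
theorem integral_spectralMeasure (T : H →L[ℂ] H) (x : H) (f : C_c(ℝ, ℝ)) :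
    ∫ t, f t ∂(spectralMeasure T x) = (⟪x, cfc (f : ℝ → ℝ) T x⟫_ℂ).re :=
  RealRMK.integral_rieszMeasure (spectralFunctional T x) f

/-- The point spectrum of a self-adjoint operator: the set of its (real) eigenvalues. -/
def pointSpectrum (T : H →L[ℂ] H) : Set ℝ :=
  {t | Module.End.HasEigenvalue (T : H →ₗ[ℂ] H) (t : ℂ)}

/-- The continuous spectrum of a self-adjoint operator (whose residual spectrum is empty): the
points of the spectrum that are not eigenvalues. -/
def continuousSpectrum (T : H →L[ℂ] H) : Set ℝ :=
  spectrum ℝ T \ pointSpectrum T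

/-- An at most countable partition of the continuous spectrum of `T` into Borel subsets of the
topological space `continuousSpectrum T`. If `continuousSpectrum T` is a Borel set of `ℝ` (for
example, if `H` is separable, since then there are only countably many eigenvalues), these are
just the Borel sets of `ℝ` contained in it. (In the remaining case a measure on `ℝ` is evaluated on
them as the trace measure on `continuousSpectrum T`, that is, as an outer measure.) The index set is a `Type`, which is no restriction
for a countable set; empty members are allowed and contribute nothing to the entropy. -/
structure ContinuousSpectrumPartition (T : H →L[ℂ] H) where
  /-- The index set. -/
  ι : Type
  countable : Countable ι
  /-- The members of the partition. -/
  part : ι → Set ℝ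
  measurable : ∀ i, MeasurableSet ((↑) ⁻¹' part i : Set (continuousSpectrum T))
  disjoint : Pairwise fun i j => Disjoint (part i) (part j)
  iUnion_part : ⋃ i, part i = continuousSpectrum T

end Spectral

/-! ### States, the GNS representation and entropy -/

section CStar

variable {A : Type*} [CStarAlgebra A] [PartialOrder A] [StarOrderedRing A]

variable (A) in
/-- A state: a positive linear functional `ω` with `ω 1 = 1`. -/
structure CStarState where
  /-- The underlying positive linear functional. -/
  functional : A →ₚ[ℂ] ℂ
  map_one : functional 1 = 1

namespace CStarState

/-- The Hilbert space of the GNS representation of `ω`. -/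
abbrev Space (ω : CStarState A) : Type _ := ω.functional.GNS

/-- The operator representing `a` in the GNS representation of `ω`. -/
def op (ω : CStarState A) (a : A) : ω.Space →L[ℂ] ω.Space :=
  ω.functional.gnsStarAlgHom a

/-- The cyclic vector of the GNS representation of `ω`: the class of the unit. -/
def vector (ω : CStarState A) : ω.Space :=
  ((ω.functional.toPreGNS 1 : ω.functional.PreGNS) : ω.functional.GNS)

/-- The distribution of the self-adjoint element `a` in the state `ω`: the spectral measure, at the
cyclic vector, of the operator representing `a`. -/
def distribution (ω : CStarState A) (a : A) : MeasureTheory.Measure ℝ :=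
  spectralMeasure (ω.op a) ω.vector

/-- The probabilities of the eigenvalues and of the members of the partition `ε`. -/
def prob (ω : CStarState A) (a : A) (ε : ContinuousSpectrumPartition (ω.op a)) :
    pointSpectrum (ω.op a) ⊕ ε.ι → ℝ
  | Sum.inl t => (ω.distribution a).real {(t : ℝ)}
  | Sum.inr i => (ω.distribution a).real (ε.part i)

/-- The Shannon entropy `- ∑ p log p ∈ [0, ∞]` of `a` in the state `ω` for the partition `ε`, with
`0 log 0 = 0`. The sum has nonnegative terms, because the `p` are probabilities. -/
def entropy (ω : CStarState A) (a : A) (ε : ContinuousSpectrumPartition (ω.op a)) : ℝ≥0∞ :=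
  ∑' i, ENNReal.ofReal (Real.negMulLog (ω.prob a ε i))

end CStarState

/-- The entropic uncertainty relation of `a` and `b` for the partitions `ε` and `δ` (of the
continuous spectra in all GNS representations): the sum of the entropies is bounded below by a
positive constant that does not depend on the state. -/
def EntropicUncertaintyRelation (a b : A)
    (ε : ∀ ω : CStarState A, ContinuousSpectrumPartition (ω.op a))
    (δ : ∀ ω : CStarState A, ContinuousSpectrumPartition (ω.op b)) : Prop :=
  ∃ C : ℝ, 0 < C ∧
    ∀ ω : CStarState A, ENNReal.ofReal C ≤ ω.entropy a (ε ω) + ω.entropy b (δ ω)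

end CStar

end

/-!
If self-adjoint elements `a` and `b` commute, some state has zero entropy for both of them, so no
positive lower bound on the sum of the entropies can hold.

Such a state comes from a character `φ` of the commutative C⋆-algebra `S` generated by `a` and `b`
(`Commute.exists_isClosed_starSubalgebra_algHom`), extended to a state `ω` of the whole algebra
(`StarSubalgebra.exists_state_extending`). Since `φ` is multiplicative, `ω` has zero variance at
`a` and at `b`, so its cyclic GNS vector is a common eigenvector of the operators representing
them. The spectral measure at a unit eigenvector is a point mass at the eigenvalue
(`spectralMeasure_eq_dirac`); the eigenvalue belongs to the point spectrum and hence to no member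
of a partition of the continuous spectrum, so every term of the entropy is `0 log 0` or `1 log 1`
(`CStarState.entropy_eq_zero`).
-/

open scoped InnerProductSpace ComplexOrder
open MeasureTheory

/-! ### Spectral measures at eigenvectors -/

section Eigenvector

variable {H : Type*} [NormedAddCommGroup H] [InnerProductSpace ℂ H]

theorem mem_spectrum_of_apply_eq_smul {T : H →L[ℂ] H} {l : ℝ} {x : H}
    (hx : T x = (l : ℂ) • x) (hx0 : x ≠ 0) : l ∈ spectrum ℝ T := by
  rw [spectrum.mem_iff]
  rintro ⟨u, hu⟩
  refine hx0 ?_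
  have h : (u : H →L[ℂ] H) x = 0 := by
    rw [hu, Algebra.algebraMap_eq_smul_one]
    simp [hx]
  calc x = (↑u⁻¹ * ↑u : H →L[ℂ] H) x := by simp
    _ = 0 := by rw [mul_apply_eq_comp, h, map_zero]

variable [CompleteSpace H]

/-- The continuous functional calculus maps eigenvectors to eigenvectors. The functions `f` with
this property form a closed subalgebra containing the identity, so Stone–Weierstrass applies. -/
theorem IsSelfAdjoint.cfc_apply_eigenvector {T : H →L[ℂ] H} (hT : IsSelfAdjoint T) {l : ℝ}
    {x : H} (hx : T x = (l : ℂ) • x) (hx0 : x ≠ 0) {f : ℝ → ℝ} (hf : Continuous f) :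
    cfc f T x = (f l : ℂ) • x := by
  have hl := mem_spectrum_of_apply_eq_smul hx hx0
  have key (g : C(spectrum ℝ T, ℝ)) :
      cfcHom (R := ℝ) hT g x = ((g ⟨l, hl⟩ : ℝ) : ℂ) • x := by
    have hid : cfcHom (R := ℝ) hT (.restrict (spectrum ℝ T) (.id ℝ)) x = (l : ℂ) • x := by
      rw [cfcHom_id hT, hx]
    induction g using ContinuousMap.induction_on_of_compact with
    | const r =>
      have : (ContinuousMap.const (spectrum ℝ T) r) = algebraMap ℝ C(spectrum ℝ T, ℝ) r := rfl
      rw [this, AlgHomClass.commutes, Algebra.algebraMap_eq_smul_one]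
      simp
    | id => exact hid
    | star_id => rwa [star_trivial]
    | add f g hf hg => simp [hf, hg, add_smul]
    | mul f g hf hg =>
      rw [map_mul, mul_apply_eq_comp, hg, map_smul, hf, ContinuousMap.mul_apply,
        Complex.ofReal_mul, smul_smul, mul_comm]
    | frequently f h =>
      refine h.mem_of_closed (isClosed_eq ?_ ?_)
      · exact (ContinuousLinearMap.apply ℂ H x).continuous.comp (cfcHom_continuous hT)
      · fun_prop
  rw [cfc_apply f T hT hf.continuousOn, key]
  rfl

/-- The spectral measure of `T` at a unit eigenvector is the point mass at the eigenvalue. -/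
theorem spectralMeasure_eq_dirac {T : H →L[ℂ] H} (hT : IsSelfAdjoint T) {l : ℝ}
    {x : H} (hx : T x = (l : ℂ) • x) (hn : ‖x‖ = 1) :
    spectralMeasure T x = Measure.dirac l := by
  have : (spectralMeasure T x).Regular := RealRMK.regular_rieszMeasure _
  have hx0 : x ≠ 0 := by
    rintro rfl
    simp at hn
  refine Measure.ext_of_integral_eq_on_compactlySupported fun f => ?_
  have hf : cfc (f : ℝ → ℝ) T x = (f l : ℂ) • x := hT.cfc_apply_eigenvector hx hx0 f.continuous
  rw [integral_spectralMeasure, integral_dirac, hf,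
    inner_smul_right, inner_self_eq_norm_sq_to_K, hn]
  simp

end Eigenvector

/-! ### Characters of commutative subalgebras and their extension to states -/

section States

variable {A : Type*} [CStarAlgebra A]

open scoped IsMulCommutative in
/-- Commuting self-adjoint elements lie in a closed star subalgebra that has a character: the
closed star subalgebra they generate is commutative and nonzero, so Gelfand theory applies. -/
theorem Commute.exists_isClosed_starSubalgebra_algHom [Nontrivial A] {a b : A}
    (ha : IsSelfAdjoint a) (hb : IsSelfAdjoint b) (hab : Commute a b) :
    ∃ S : StarSubalgebra ℂ A, IsClosed (S : Set A) ∧ a ∈ S ∧ b ∈ S ∧ Nonempty (S →ₐ[ℂ] ℂ) := by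
  let S : StarSubalgebra ℂ A := (StarAlgebra.adjoin ℂ {a, b}).topologicalClosure
  have hS : IsClosed (S : Set A) := (StarAlgebra.adjoin ℂ {a, b}).isClosed_topologicalClosure
  have hsub : ({a, b} : Set A) ⊆ S :=
    (StarAlgebra.subset_adjoin ℂ _).trans (StarSubalgebra.le_topologicalClosure _)
  have : IsMulCommutative (StarAlgebra.adjoin ℂ {a, b}) :=
    StarAlgebra.isMulCommutative_adjoin ℂ
      (by rintro x (rfl | rfl) y (rfl | rfl) <;> first | rfl | exact hab | exact hab.symm)
      (by rintro x (rfl | rfl) y (rfl | rfl) <;> simp only [ha.star_eq, hb.star_eq] <;>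
            first | rfl | exact hab | exact hab.symm)
  refine ⟨S, hS, hsub (by simp), hsub (by simp), ?_⟩
  have : CompleteSpace S := hS.completeSpace_coe
  let _ : NormedCommRing S :=
    { (inferInstance : NormedRing S),
      StarSubalgebra.commRingTopologicalClosure (StarAlgebra.adjoin ℂ {a, b}) mul_comm with }
  let _ : NormedAlgebra ℂ S := { (inferInstance : Algebra ℂ S) with norm_smul_le := norm_smul_le }
  obtain ⟨φ⟩ : Nonempty (WeakDual.characterSpace ℂ S) := inferInstance
  exact ⟨WeakDual.CharacterSpace.toAlgHom φ⟩

variable [PartialOrder A] [StarOrderedRing A]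

/-- A character `φ` of a closed star subalgebra `S` extends to a state: by spectral permanence
`Re φ` is nonnegative on the elements of `S` with nonnegative real part, so the M. Riesz extension
theorem extends it to a real functional on `A` with the same property, which is the real part of a
positive complex functional. -/
theorem StarSubalgebra.exists_state_extending (S : StarSubalgebra ℂ A) [IsClosed (S : Set A)]
    (φ : S →ₐ[ℂ] ℂ) : ∃ ω : CStarState A, ∀ x : S, ω.functional x = φ x := by
  have hpos (x : S) (hx : 0 ≤ (x : A)) : 0 ≤ φ x := by
    have h := AlgHom.apply_mem_spectrum φ x
    rw [S.spectrum_eq] at h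
    exact spectrum_nonneg_of_nonneg hx h
  have hstar (x : S) : φ (star x) = star (φ x) := map_star φ x
  -- The cone of the elements with nonnegative real part. A functional that is nonnegative on it
  -- vanishes on the skew-adjoint elements.
  let s : PointedCone ℝ A :=
    { carrier := {y | 0 ≤ y + star y}
      add_mem' := fun {y z} (hy : 0 ≤ y + star y) (hz : 0 ≤ z + star z) => by
        change 0 ≤ y + z + star (y + z)
        rw [star_add, add_add_add_comm]
        exact add_nonneg hy hz
      zero_mem' := by simp
      smul_mem' := fun c y (hy : 0 ≤ y + star y) => by
        change 0 ≤ (c : ℝ) • y + star ((c : ℝ) • y)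
        rw [star_smul, star_trivial, ← smul_add]
        exact smul_nonneg c.2 hy }
  let f : A →ₗ.[ℝ] ℝ :=
    { domain := S.toSubalgebra.toSubmodule.restrictScalars ℝ
      toFun := Complex.reLm ∘ₗ φ.toLinearMap.restrictScalars ℝ }
  obtain ⟨g, hgf, hgs⟩ := riesz_extension s f (by
    rintro ⟨x, hx⟩ (hxs : 0 ≤ x + star x)
    have h := hpos (⟨x, hx⟩ + star ⟨x, hx⟩) hxs
    rw [map_add, hstar, Complex.nonneg_iff] at h
    have h1 := h.1
    simp only [Complex.add_re, Complex.star_def, Complex.conj_re] at h1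
    change 0 ≤ (φ ⟨x, hx⟩).re
    linarith) (by
    intro y
    refine ⟨⟨algebraMap ℝ A ‖y + star y‖, S.algebraMap_mem (‖y + star y‖ : ℂ)⟩, ?_⟩
    change 0 ≤ algebraMap ℝ A ‖y + star y‖ + y + star (algebraMap ℝ A ‖y + star y‖ + y)
    have h1 := neg_le_iff_add_nonneg'.1
      (IsSelfAdjoint.add_star_self y).neg_algebraMap_norm_le_self
    have h2 : 0 ≤ algebraMap ℝ A ‖y + star y‖ := algebraMap_nonneg A (norm_nonneg _)
    rw [star_add, (IsSelfAdjoint.algebraMap A (.all ‖y + star y‖)).star_eq, add_add_add_comm,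
      add_assoc]
    exact add_nonneg h2 h1)
  have hgI (y : A) (hy : 0 ≤ y) : g (Complex.I • y) = 0 := by
    have hsk : star (Complex.I • y) = - (Complex.I • y) := by
      simp [star_smul, (IsSelfAdjoint.of_nonneg hy).star_eq]
    have h1 : 0 ≤ g (Complex.I • y) := hgs _ (by
      change 0 ≤ Complex.I • y + star (Complex.I • y)
      simp [hsk])
    have h2 : 0 ≤ g (-(Complex.I • y)) := hgs _ (by
      change 0 ≤ -(Complex.I • y) + star (-(Complex.I • y))
      simp [hsk])
    rw [map_neg] at h2
    linarith
  let ω : A →ₗ[ℂ] ℂ := Module.Dual.extendRCLike g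
  have hgφ (x : S) : g x = (φ x).re := hgf ⟨x, x.2⟩
  have hω (x : S) : ω x = φ x := by
    have h : g (Complex.I • (x : A)) = (Complex.I * φ x).re := by
      rw [← smul_eq_mul, ← map_smul]
      exact hgφ (Complex.I • x)
    apply Complex.ext
    · exact (Module.Dual.re_extendRCLike_apply (𝕜 := ℂ) g (x : A)).trans (hgφ x)
    · refine (Module.Dual.im_extendRCLike_apply (𝕜 := ℂ) g (x : A)).trans ?_
      change -g (Complex.I • (x : A)) = _
      simp [h]
  have hω_nonneg (y : A) (hy : 0 ≤ y) : 0 ≤ ω y := by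
    rw [Complex.nonneg_iff]
    constructor
    · refine le_of_le_of_eq (hgs y ?_) (Module.Dual.re_extendRCLike_apply (𝕜 := ℂ) g y).symm
      change 0 ≤ y + star y
      rw [(IsSelfAdjoint.of_nonneg hy).star_eq]
      exact add_nonneg hy hy
    · refine .trans ?_ (Module.Dual.im_extendRCLike_apply (𝕜 := ℂ) g y).symm
      change 0 = -g (Complex.I • y)
      rw [hgI y hy, neg_zero]
  exact ⟨⟨PositiveLinearMap.mk₀ ω hω_nonneg, (hω 1).trans (map_one φ)⟩, hω⟩

/-! ### Entropy of dispersion-free states -/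

namespace CStarState

theorem norm_vector (ω : CStarState A) : ‖ω.vector‖ = 1 := by
  rw [vector, UniformSpace.Completion.norm_coe, PositiveLinearMap.preGNS_norm_def]
  simp [ω.map_one]

theorem isSelfAdjoint_op (ω : CStarState A) {a : A} (ha : IsSelfAdjoint a) :
    IsSelfAdjoint (ω.op a) :=
  ha.map ω.functional.gnsStarAlgHom

theorem op_vector_eq_zero (ω : CStarState A) {c : A} (hc : ω.functional (star c * c) = 0) :
    ω.op c ω.vector = 0 := by
  have h : ω.op c ω.vector = ((ω.functional.toPreGNS c : ω.functional.PreGNS) : ω.Space) := by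
    change ω.functional.gnsNonUnitalStarAlgHom c _ = _
    rw [vector, PositiveLinearMap.gnsNonUnitalStarAlgHom_apply_coe]
    simp
  rw [h, ← norm_eq_zero, UniformSpace.Completion.norm_coe, PositiveLinearMap.preGNS_norm_def]
  simp [hc]

/-- If `ω` has zero variance at `a`, its cyclic vector is an eigenvector of `a`. -/
theorem op_vector_eq_smul (ω : CStarState A) {a : A} {l : ℂ}
    (hl : ω.functional (star (a - algebraMap ℂ A l) * (a - algebraMap ℂ A l)) = 0) :
    ω.op a ω.vector = l • ω.vector := by
  have h := ω.op_vector_eq_zero hl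
  have h' : ω.op (a - algebraMap ℂ A l) = ω.op a - l • 1 := by
    rw [op, map_sub, AlgHomClass.commutes, Algebra.algebraMap_eq_smul_one]
    rfl
  rw [h'] at h
  simpa [sub_eq_zero] using h

/-- The entropy vanishes if the cyclic vector is an eigenvector, whatever the partition: all the
mass sits at the eigenvalue, which the members of the partition do not contain. -/
theorem entropy_eq_zero (ω : CStarState A) {a : A} (ha : IsSelfAdjoint a) {l : ℝ}
    (hl : ω.op a ω.vector = (l : ℂ) • ω.vector) (ε : ContinuousSpectrumPartition (ω.op a)) :
    ω.entropy a ε = 0 := by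
  have hd : ω.distribution a = Measure.dirac l :=
    spectralMeasure_eq_dirac (ω.isSelfAdjoint_op ha) hl ω.norm_vector
  have hmem : l ∈ pointSpectrum (ω.op a) :=
    Module.End.hasEigenvalue_of_hasEigenvector (x := ω.vector)
      ⟨Module.End.mem_eigenspace_iff.2 hl, norm_ne_zero_iff.1 (by simp [ω.norm_vector])⟩
  refine ENNReal.tsum_eq_zero.2 fun i => ?_
  suffices ω.prob a ε i = 0 ∨ ω.prob a ε i = 1 by
    rcases this with h | h <;> simp [h]
  rcases i with t | i
  · by_cases ht : (t : ℝ) = l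
    · right
      simp [prob, hd, Measure.real, ht]
    · left
      simp [prob, hd, Measure.real, Ne.symm ht]
  · left
    have hsub : ε.part i ⊆ {l}ᶜ := by
      rintro y hy rfl
      have : y ∈ continuousSpectrum (ω.op a) := ε.iUnion_part ▸ Set.mem_iUnion_of_mem i hy
      exact this.2 hmem
    -- Monotonicity of the outer measure suffices: `ε.part i` need not be Borel in `ℝ`.
    have h0 : Measure.dirac l (ε.part i) = 0 := measure_mono_null hsub (by simp)
    simp [prob, hd, Measure.real, h0]

/-- A state that restricts to a character on a subalgebra has zero entropy at its self-adjoint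
elements: with `c = a - φ a` one has `ω (star c * c) = φ (star c) * φ c = 0`. -/
theorem entropy_eq_zero_of_algHom (ω : CStarState A) (S : StarSubalgebra ℂ A)
    [IsClosed (S : Set A)] (φ : S →ₐ[ℂ] ℂ) (hω : ∀ x : S, ω.functional x = φ x) {a : A}
    (ha : IsSelfAdjoint a) (haS : a ∈ S) (ε : ContinuousSpectrumPartition (ω.op a)) :
    ω.entropy a ε = 0 := by
  have hreal : ((φ ⟨a, haS⟩).re : ℂ) = φ ⟨a, haS⟩ := by
    refine Complex.conj_eq_iff_re.1 ?_
    rw [← Complex.star_def, ← map_star]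
    exact congrArg φ (Subtype.ext ha.star_eq)
  refine ω.entropy_eq_zero ha (l := (φ ⟨a, haS⟩).re) (ω.op_vector_eq_smul ?_) ε
  rw [hreal]
  let c : S := ⟨a, haS⟩ - algebraMap ℂ S (φ ⟨a, haS⟩)
  have hc : φ c = 0 := by simp [c]
  exact (hω (star c * c)).trans (by rw [map_mul, hc, mul_zero])

end CStarState

end States

theorem theorem6 {A : Type*} [CStarAlgebra A] [Nontrivial A] [PartialOrder A] [StarOrderedRing A]
    (a b : A) (ha : IsSelfAdjoint a) (hb : IsSelfAdjoint b)
    (ε : ∀ ω : CStarState A, ContinuousSpectrumPartition (ω.op a))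
    (δ : ∀ ω : CStarState A, ContinuousSpectrumPartition (ω.op b))
    (h : EntropicUncertaintyRelation a b ε δ) :
    ⁅a, b⁆ ≠ 0 := by
  intro hab
  obtain ⟨C, hC, hle⟩ := h
  obtain ⟨S, hS, haS, hbS, ⟨φ⟩⟩ :=
    Commute.exists_isClosed_starSubalgebra_algHom ha hb (commute_iff_lie_eq.2 hab)
  obtain ⟨ω, hω⟩ := S.exists_state_extending φ
  have hω_le := hle ω
  rw [ω.entropy_eq_zero_of_algHom S φ hω ha haS, ω.entropy_eq_zero_of_algHom S φ hω hb hbS,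
    add_zero, nonpos_iff_eq_zero, ENNReal.ofReal_eq_zero] at hω_le
  exact hC.not_ge hω_le
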